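/- For a positive integer $n$, let $h_n$ be the maximum value of a determinant of order $n$ all of whose entries are $0$ or $1$, and let $\nu_n$ be the maximum volume of an $n$-dimensional simplex contained in the unit cube $Q_n=[0,1]^n\subset\mathbb{R}^n$. There exist constants $c, c_1>0$, not depending on $n$, such that for every integer $n\ge 1$ $$\frac{h_{n+1}}{h_n}\ \ge\ c\sqrt{n},\qquad \frac{\nu_n}{\nu_{n+1}}\ \le\ c_1\sqrt{n}.$$ -/

import Mathlib

/-- The set of all values of determinants of order `n` with entries `0` or `1`. -/
def zeroOneDets (n : ℕ) : Set ℝ :=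
  {d | ∃ A : Matrix (Fin n) (Fin n) ℝ, (∀ i j, A i j = 0 ∨ A i j = 1) ∧ A.det = d}

/-- `h_n`: the maximum of a determinant of order `n` with entries `0` or `1`
(the maximum is attained, see `isGreatest_maxDet`). -/
noncomputable def maxDet (n : ℕ) : ℝ := sSup (zeroOneDets n)

/-- The unit cube `Q_n = [0,1]^n` in `ℝⁿ`. -/
def unitCube (n : ℕ) : Set (Fin n → ℝ) := {x | ∀ i, 0 ≤ x i ∧ x i ≤ 1}

/-- The set of all volumes (Lebesgue measures) of `n`-dimensional (nondegenerate) simplices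
contained in `Q_n`; the simplex is the convex hull of its `n + 1` affinely independent vertices. -/
def simplexVolumes (n : ℕ) : Set ℝ :=
  {v | ∃ S : Affine.Simplex ℝ (Fin n → ℝ) n,
    convexHull ℝ (Set.range S.points) ⊆ unitCube n ∧
    MeasureTheory.volume.real (convexHull ℝ (Set.range S.points)) = v}

/-- `ν_n`: the maximum volume of an `n`-dimensional simplex contained in `Q_n`
(the maximum is attained, see `isGreatest_maxSimplexVolume`). -/
noncomputable def maxSimplexVolume (n : ℕ) : ℝ := sSup (simplexVolumes n)

theorem isGreatest_maxDet (n : ℕ) : IsGreatest (zeroOneDets n) (maxDet n) := by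
  have hfin : (zeroOneDets n).Finite := by
    have h1 : {A : Matrix (Fin n) (Fin n) ℝ | ∀ i j, A i j = 0 ∨ A i j = 1}.Finite := by
      have := Set.Finite.pi' (ι := Fin n) (fun _ => Set.Finite.pi' (ι := Fin n)
        (fun _ => Set.toFinite ({0, 1} : Set ℝ)))
      exact this
    refine (h1.image Matrix.det).subset ?_
    rintro d ⟨A, hA, rfl⟩
    exact ⟨A, hA, rfl⟩
  have hne : (zeroOneDets n).Nonempty := by
    refine ⟨1, 1, fun i j => ?_, Matrix.det_one⟩
    rw [Matrix.one_apply]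
    split_ifs
    · exact Or.inr rfl
    · exact Or.inl rfl
  exact ⟨hne.csSup_mem hfin, fun x hx => le_csSup hfin.bddAbove hx⟩

theorem maxDet_pos (n : ℕ) : 0 < maxDet n := by
  refine lt_of_lt_of_le one_pos ((isGreatest_maxDet n).2 ⟨1, fun i j => ?_, Matrix.det_one⟩)
  rw [Matrix.one_apply]
  split_ifs
  · exact Or.inr rfl
  · exact Or.inl rfl

theorem convex_unitCube (n : ℕ) : Convex ℝ (unitCube n) := by
  have : unitCube n = Set.Icc 0 1 := by
    ext x
    simp only [unitCube, Set.mem_ofPred_eq, Set.mem_Icc, Pi.le_def, forall_and]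
    rfl
  rw [this]
  exact convex_Icc 0 1

theorem isCompact_unitCube (n : ℕ) : IsCompact (unitCube n) := by
  have : unitCube n = Set.Icc 0 1 := by
    ext x
    simp only [unitCube, Set.mem_ofPred_eq, Set.mem_Icc, Pi.le_def, forall_and]
    rfl
  rw [this]
  exact isCompact_Icc

/-- The convex hull of `n + 1` points of `ℝⁿ` has positive volume iff the points are
affinely independent. -/
theorem volume_hull_pos_iff {n : ℕ} (p : Fin (n + 1) → (Fin n → ℝ)) :
    0 < MeasureTheory.volume.real (convexHull ℝ (Set.range p)) ↔ AffineIndependent ℝ p := by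
  have hcpt : IsCompact (convexHull ℝ (Set.range p)) :=
    (Set.finite_range p).isCompact_convexHull ℝ
  constructor
  · intro h
    rw [affineIndependent_iff_finrank_vectorSpan_eq ℝ p (n := n) (by simp)]
    have htop : affineSpan ℝ (Set.range p) = ⊤ := by
      by_contra hne
      have h0 := MeasureTheory.Measure.addHaar_affineSubspace
        (MeasureTheory.volume : MeasureTheory.Measure (Fin n → ℝ)) _ hne
      have h1 := MeasureTheory.measure_mono_null
        (convexHull_subset_affineSpan (𝕜 := ℝ) (Set.range p)) h0
      rw [MeasureTheory.measureReal_def, h1] at h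
      simp at h
    rw [← direction_affineSpan, htop, AffineSubspace.direction_top, finrank_top,
      Module.finrank_fin_fun]
  · intro h
    have htop : affineSpan ℝ (Set.range p) = ⊤ := by
      rw [h.affineSpan_eq_top_iff_card_eq_finrank_add_one]
      simp
    have hint := interior_convexHull_nonempty_iff_affineSpan_eq_top.2 htop
    exact ENNReal.toReal_pos
      (MeasureTheory.Measure.measure_pos_of_nonempty_interior _ hint).ne'
      hcpt.measure_lt_top.ne

theorem continuous_volume_hull (n : ℕ) :
    Continuous fun p : Fin (n + 1) → (Fin n → ℝ) =>
      MeasureTheory.volume.real (convexHull ℝ (Set.range p)) := by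
  let q : Fin (n + 1) → (Fin n → ℝ) := Fin.cons 0 fun i => Pi.single i 1
  let M : (Fin (n + 1) → (Fin n → ℝ)) → Matrix (Fin n) (Fin n) ℝ :=
    fun p => Matrix.of fun i j => p j.succ i - p 0 i
  have key : ∀ p : Fin (n + 1) → (Fin n → ℝ),
      MeasureTheory.volume.real (convexHull ℝ (Set.range p)) =
        |(M p).det| * MeasureTheory.volume.real (convexHull ℝ (Set.range q)) := by
    intro p
    have hp : Set.range p = (fun x => p 0 + x) '' (Matrix.toLin' (M p) '' Set.range q) := by
      rw [← Set.range_comp, ← Set.range_comp]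
      congr 1
      funext k
      refine Fin.cases ?_ (fun j => ?_) k
      · simp [q]
      · funext i
        simp [q, M]
    have hh : convexHull ℝ (Set.range p) =
        (fun x => p 0 + x) '' (Matrix.toLin' (M p) '' convexHull ℝ (Set.range q)) := by
      rw [hp, LinearMap.image_convexHull]
      have := convexHull_vadd (𝕜 := ℝ) (p 0) (Matrix.toLin' (M p) '' Set.range q)
      exact this
    rw [hh, MeasureTheory.measureReal_def, Set.image_add_left,
      MeasureTheory.measure_preimage_add, MeasureTheory.Measure.addHaar_image_linearMap,
      ENNReal.toReal_mul, ENNReal.toReal_ofReal (abs_nonneg _), LinearMap.det_toLin',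
      MeasureTheory.measureReal_def]
  rw [funext key]
  have hM : Continuous M := by
    refine continuous_matrix fun i j => ?_
    simp only [M, Matrix.of_apply]
    fun_prop
  exact (hM.matrix_det.abs).mul continuous_const

theorem isGreatest_maxSimplexVolume (n : ℕ) :
    IsGreatest (simplexVolumes n) (maxSimplexVolume n) := by
  obtain ⟨p, hp, hmax⟩ := (isCompact_univ_pi
    (fun _ : Fin (n + 1) => isCompact_unitCube n)).exists_isMaxOn
    ⟨fun _ _ => 0, fun _ _ _ => ⟨le_rfl, zero_le_one⟩⟩ (continuous_volume_hull n).continuousOn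
  have hindep : AffineIndependent ℝ p := by
    let q : Fin (n + 1) → (Fin n → ℝ) := Fin.cons 0 fun i => Pi.single i 1
    have hq : AffineIndependent ℝ q := by
      rw [affineIndependent_iff_linearIndependent_vsub ℝ q 0]
      have hb : LinearIndependent ℝ (fun i : Fin n => (Pi.single i 1 : Fin n → ℝ)) := by
        have h := (Pi.basisFun ℝ (Fin n)).linearIndependent
        have he : ⇑(Pi.basisFun ℝ (Fin n)) = fun i => (Pi.single i 1 : Fin n → ℝ) :=
          funext fun i => Pi.basisFun_apply ℝ (Fin n) i
        rwa [he] at h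
      refine (linearIndependent_equiv (finSuccAboveEquiv (0 : Fin (n + 1)))).1 ?_
      have he : (fun x : {x : Fin (n + 1) // x ≠ 0} => (q x -ᵥ q 0 : Fin n → ℝ)) ∘
          (finSuccAboveEquiv (0 : Fin (n + 1))) = fun i => (Pi.single i 1 : Fin n → ℝ) := by
        funext y
        simp [q, finSuccAboveEquiv_apply]
      rw [he]
      exact hb
    have hqc : q ∈ Set.univ.pi fun _ : Fin (n + 1) => unitCube n := by
      intro k _
      refine Fin.cases ?_ (fun j => ?_) k
      · intro i; simp [q]
      · intro i
        by_cases h : i = j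
        · subst h; simp [q]
        · simp [q, h]
    exact (volume_hull_pos_iff p).1 (((volume_hull_pos_iff q).2 hq).trans_le (hmax hqc))
  have hg : IsGreatest (simplexVolumes n)
      (MeasureTheory.volume.real (convexHull ℝ (Set.range p))) := by
    refine ⟨⟨⟨p, hindep⟩, convexHull_min ?_ (convex_unitCube n), rfl⟩, ?_⟩
    · rintro _ ⟨k, rfl⟩
      exact hp k trivial
    · rintro v ⟨S, hS, rfl⟩
      exact hmax (fun k _ => hS (subset_convexHull ℝ _ ⟨k, rfl⟩))
  rw [maxSimplexVolume, hg.csSup_eq]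
  exact hg

theorem maxSimplexVolume_pos (n : ℕ) : 0 < maxSimplexVolume n := by
  obtain ⟨S, -, hS⟩ := (isGreatest_maxSimplexVolume n).1
  rw [← hS]
  exact (volume_hull_pos_iff S.points).2 S.independent

/-!
Let `A` be a 0-1 matrix of order `n` whose determinant is `h_n`. Bordering `A` by a row `x`, a
column `y` and a corner entry `0` gives a matrix of determinant `-det A * (x A⁻¹ y)`, so it is
enough to find 0-1 vectors with `|x A⁻¹ y|` of order `√n`. The rows of `A` have Euclidean norm at
most `√n`, hence the columns of `A⁻¹` have norm at least `1 / √n`, and these `n` norms add up to at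
least `√n`. By Khinchine's inequality, which follows from the second and fourth moments of a random
signed sum, some sign vector `ε` has `‖ε A⁻¹‖₁ ≥ √n / √3`; passing from signs to 0-1 vectors on
both sides costs a factor of at most `4`.

For the simplices, `ν_n = h_n / n!`. A simplex has volume `|det M| / n!` with `M` the matrix of its
edges at one vertex. Row `i` of `M` depends only on the `i`-th coordinates of the vertices, and
`det M` is linear in each row, so `|det M|` is largest when all vertices of the simplex are
vertices of the cube. If the base vertex has `i`-th coordinate `0`, row `i` is then a 0-1 vector; if
it is `1`, the negative of one.
-/

open MeasureTheory Matrix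
open scoped BigOperators Nat

section Khinchine

theorem sum_sq_pow_three_le {ι : Type*} (s : Finset ι) (f : ι → ℝ) :
    (∑ i ∈ s, f i ^ 2) ^ 3 ≤ (∑ i ∈ s, |f i|) ^ 2 * ∑ i ∈ s, f i ^ 4 := by
  have sq_sum_sq_le : (∑ i ∈ s, f i ^ 2) ^ 2 ≤ (∑ i ∈ s, |f i|) * ∑ i ∈ s, |f i| ^ 3 :=
    s.sum_sq_le_sum_mul_sum_of_sq_le_mul (fun _ _ => abs_nonneg _) (fun _ _ => by positivity)
      fun i _ => by rw [← sq_abs (f i), ← pow_succ', ← pow_mul]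
  have sq_sum_cube_le : (∑ i ∈ s, |f i| ^ 3) ^ 2 ≤ (∑ i ∈ s, f i ^ 2) * ∑ i ∈ s, f i ^ 4 :=
    s.sum_sq_le_sum_mul_sum_of_sq_le_mul (fun _ _ => by positivity) (fun _ _ => by positivity)
      fun i _ => by rw [← pow_mul, mul_comm 3, pow_mul, sq_abs, ← pow_add, ← pow_mul]
  rcases (s.sum_nonneg fun i _ => sq_nonneg (f i)).eq_or_lt with h | hpos
  · rw [← h, zero_pow three_ne_zero]
    exact mul_nonneg (sq_nonneg _) (s.sum_nonneg fun _ _ => by positivity)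
  refine le_of_mul_le_mul_left ?_ hpos
  calc (∑ i ∈ s, f i ^ 2) * (∑ i ∈ s, f i ^ 2) ^ 3
      = ((∑ i ∈ s, f i ^ 2) ^ 2) ^ 2 := by ring
    _ ≤ ((∑ i ∈ s, |f i|) * ∑ i ∈ s, |f i| ^ 3) ^ 2 := by gcongr
    _ = (∑ i ∈ s, |f i|) ^ 2 * (∑ i ∈ s, |f i| ^ 3) ^ 2 := mul_pow _ _ _
    _ ≤ (∑ i ∈ s, |f i|) ^ 2 * ((∑ i ∈ s, f i ^ 2) * ∑ i ∈ s, f i ^ 4) := by gcongr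
    _ = (∑ i ∈ s, f i ^ 2) * ((∑ i ∈ s, |f i|) ^ 2 * ∑ i ∈ s, f i ^ 4) := by ring

theorem expect_sq_pow_three_le {ι : Type*} (s : Finset ι) (f : ι → ℝ) :
    (𝔼 i ∈ s, f i ^ 2) ^ 3 ≤ (𝔼 i ∈ s, |f i|) ^ 2 * 𝔼 i ∈ s, f i ^ 4 := by
  simp only [Finset.expect_eq_sum_div_card, div_pow, div_mul_div_comm, ← pow_succ]
  gcongr
  exact sum_sq_pow_three_le s f

variable {ι : Type*} [Fintype ι] [DecidableEq ι]

theorem expect_units_smul_sum_insert {E : Type*} [AddCommGroup E] (f : E → ℝ) (a : ι → E)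
    {s : Finset ι} {i : ι} (hi : i ∉ s) :
    𝔼 ε : ι → ℤˣ, f (∑ j ∈ insert i s, ε j • a j) =
      𝔼 ε : ι → ℤˣ, (f (∑ j ∈ s, ε j • a j + a i) + f (∑ j ∈ s, ε j • a j - a i)) / 2 := by
  have expect_flip : 𝔼 ε : ι → ℤˣ, f (∑ j ∈ insert i s, ε j • a j) =
      𝔼 ε : ι → ℤˣ, f (∑ j ∈ s, ε j • a j - ε i • a i) := by
    refine Fintype.expect_equiv (Equiv.mulRight (Pi.mulSingle i (-1) : ι → ℤˣ)) _ _ fun ε => ?_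
    have hsum : ∑ j ∈ s, (ε * Pi.mulSingle i (-1) : ι → ℤˣ) j • a j = ∑ j ∈ s, ε j • a j :=
      Finset.sum_congr rfl fun j hj => by simp [ne_of_mem_of_not_mem hj hi]
    rw [Finset.sum_insert hi, Equiv.coe_mulRight, hsum]
    simp [add_comm]
  rw [← Finset.expect_div, eq_div_iff two_ne_zero, mul_two]
  nth_rw 2 [expect_flip]
  rw [← Finset.expect_add_distrib]
  refine Finset.expect_congr rfl fun ε _ => ?_
  rw [Finset.sum_insert hi, add_comm (ε i • a i)]
  rcases Int.units_eq_one_or (ε i) with h | h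
  · simp [h]
  · simp [h, add_comm, sub_eq_add_neg]

theorem expect_units_smul_sum_sq (a : ι → ℝ) (s : Finset ι) :
    𝔼 ε : ι → ℤˣ, (∑ i ∈ s, ε i • a i) ^ 2 = ∑ i ∈ s, a i ^ 2 := by
  induction s using Finset.induction_on with
  | empty => simp
  | insert i s hi ih =>
    have parallelogram (x : ℝ) : ((x + a i) ^ 2 + (x - a i) ^ 2) / 2 = x ^ 2 + a i ^ 2 := by ring
    refine (expect_units_smul_sum_insert (· ^ 2) a hi).trans ?_
    simp only [parallelogram, Finset.expect_add_distrib, ih, Fintype.expect_const]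
    rw [Finset.sum_insert hi, add_comm]

theorem expect_units_smul_sum_pow_four_le (a : ι → ℝ) (s : Finset ι) :
    𝔼 ε : ι → ℤˣ, (∑ i ∈ s, ε i • a i) ^ 4 ≤ 3 * (∑ i ∈ s, a i ^ 2) ^ 2 := by
  induction s using Finset.induction_on with
  | empty => simp
  | insert i s hi ih =>
    have even_part (x : ℝ) : ((x + a i) ^ 4 + (x - a i) ^ 4) / 2 =
        x ^ 4 + 6 * a i ^ 2 * x ^ 2 + a i ^ 4 := by ring
    refine (expect_units_smul_sum_insert (· ^ 4) a hi).trans_le ?_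
    simp only [even_part, Finset.expect_add_distrib, ← Finset.mul_expect,
      expect_units_smul_sum_sq, Fintype.expect_const, Finset.sum_insert hi]
    nlinarith [sq_nonneg (a i ^ 2)]

theorem sqrt_sum_sq_le_expect_abs_units_smul_sum (a : ι → ℝ) :
    √(∑ i, a i ^ 2) ≤ √3 * 𝔼 ε : ι → ℤˣ, |∑ i, ε i • a i| := by
  set Q := ∑ i, a i ^ 2 with hQ
  set M := 𝔼 ε : ι → ℤˣ, |∑ i, ε i • a i| with hM
  have hQ0 : 0 ≤ Q := Finset.sum_nonneg fun i _ => sq_nonneg (a i)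
  have hM0 : 0 ≤ M := Finset.expect_nonneg fun ε _ => abs_nonneg _
  have hcube : Q ^ 2 * Q ≤ Q ^ 2 * (3 * M ^ 2) := by
    have h := expect_sq_pow_three_le Finset.univ fun ε : ι → ℤˣ => ∑ i, ε i • a i
    rw [expect_units_smul_sum_sq, ← hQ, ← hM] at h
    calc Q ^ 2 * Q = Q ^ 3 := by ring
      _ ≤ M ^ 2 * 𝔼 ε : ι → ℤˣ, (∑ i, ε i • a i) ^ 4 := h
      _ ≤ M ^ 2 * (3 * Q ^ 2) := by gcongr; exact expect_units_smul_sum_pow_four_le a _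
      _ = Q ^ 2 * (3 * M ^ 2) := by ring
  have hle : Q ≤ 3 * M ^ 2 := by
    rcases hQ0.eq_or_lt with h | hpos
    · rw [← h]
      positivity
    · exact le_of_mul_le_mul_left hcube (by positivity)
  calc √Q ≤ √(3 * M ^ 2) := Real.sqrt_le_sqrt hle
    _ = √3 * M := by rw [Real.sqrt_mul (by norm_num), Real.sqrt_sq hM0]

theorem exists_units_sum_sqrt_sum_sq_le {m n : Type*} [Fintype m] [Fintype n] (B : Matrix m n ℝ) :
    ∃ ε : m → ℤˣ, ∑ j, √(∑ i, B i j ^ 2) ≤ √3 * ∑ j, |∑ i, ε i • B i j| := by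
  classical
  have hmean : ∑ j, √(∑ i, B i j ^ 2) ≤
      𝔼 ε : m → ℤˣ, √3 * ∑ j, |∑ i, ε i • B i j| := by
    rw [← Finset.mul_expect, Finset.expect_sum_comm, Finset.mul_sum]
    gcongr with j
    exact sqrt_sum_sq_le_expect_abs_units_smul_sum fun i => B i j
  obtain ⟨ε, -, hε⟩ := Finset.exists_le_of_le_expect Finset.univ_nonempty hmean
  exact ⟨ε, hε⟩

end Khinchine

section ZeroOne

/-- A vector with entries `0` and `1`, i.e. a vertex of the unit cube. A `0`-`1` matrix `A` is
expressed as `∀ i, IsZeroOne (A i)`. -/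
def IsZeroOne {ι : Type*} (x : ι → ℝ) : Prop := ∀ i, x i = 0 ∨ x i = 1

theorem IsZeroOne.one_sub {ι : Type*} {x : ι → ℝ} (hx : IsZeroOne x) : IsZeroOne (1 - x) :=
  fun i => by rcases hx i with h | h <;> simp [h]

theorem IsZeroOne.abs_le_one {ι : Type*} {x : ι → ℝ} (hx : IsZeroOne x) (i : ι) : |x i| ≤ 1 := by
  rcases hx i with h | h <;> simp [h]

variable {ι κ : Type*} [Fintype ι] [Fintype κ]

theorem exists_isZeroOne_sum_abs_le (w : ι → ℝ) :
    ∃ x, IsZeroOne x ∧ ∑ i, |w i| ≤ 2 * |w ⬝ᵥ x| := by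
  let x : ι → ℝ := fun i => if 0 ≤ w i then 1 else 0
  have hx : IsZeroOne x := fun i => by by_cases h : 0 ≤ w i <;> simp [x, h]
  have hsplit : ∑ i, |w i| = w ⬝ᵥ x - w ⬝ᵥ (1 - x) := by
    simp only [dotProduct, ← Finset.sum_sub_distrib]
    refine Finset.sum_congr rfl fun i _ => ?_
    rcases le_or_gt 0 (w i) with h | h
    · simp [x, h, abs_of_nonneg]
    · simp [x, h.not_ge, abs_of_neg h]
  have hle : ∑ i, |w i| ≤ |w ⬝ᵥ x| + |w ⬝ᵥ (1 - x)| :=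
    hsplit ▸ (le_abs_self _).trans (abs_sub _ _)
  rcases le_total |w ⬝ᵥ (1 - x)| |w ⬝ᵥ x| with h | h
  · exact ⟨x, hx, by linarith⟩
  · exact ⟨1 - x, hx.one_sub, by linarith⟩

theorem dotProduct_le_sum_abs {v : ι → ℝ} (hv : ∀ i, |v i| ≤ 1) (w : ι → ℝ) :
    v ⬝ᵥ w ≤ ∑ i, |w i| :=
  Finset.sum_le_sum fun i _ => calc
    v i * w i ≤ |v i| * |w i| := (le_abs_self _).trans_eq (abs_mul _ _)
    _ ≤ |w i| := mul_le_of_le_one_left (abs_nonneg _) (hv i)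

theorem exists_isZeroOne_sum_abs_vecMul_le (B : Matrix ι κ ℝ) {v : ι → ℝ} (hv : ∀ i, |v i| ≤ 1) :
    ∃ x y, IsZeroOne x ∧ IsZeroOne y ∧ ∑ j, |(v ᵥ* B) j| ≤ 4 * |x ᵥ* B ⬝ᵥ y| := by
  let η : κ → ℝ := fun j => SignType.sign ((v ᵥ* B) j)
  have hη : ∀ j, |η j| ≤ 1 := fun j => by
    rcases lt_trichotomy ((v ᵥ* B) j) 0 with h | h | h <;> simp [η, h]
  obtain ⟨x, hx, hx_le⟩ := exists_isZeroOne_sum_abs_le (B *ᵥ η)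
  obtain ⟨y, hy, hy_le⟩ := exists_isZeroOne_sum_abs_le (x ᵥ* B)
  have hxη : |B *ᵥ η ⬝ᵥ x| ≤ ∑ j, |(x ᵥ* B) j| := by
    rw [dotProduct_comm, dotProduct_mulVec, dotProduct_comm]
    refine abs_le'.2 ⟨dotProduct_le_sum_abs hη _, ?_⟩
    rw [← neg_dotProduct]
    exact dotProduct_le_sum_abs (fun j => (abs_neg (η j)).trans_le (hη j)) _
  refine ⟨x, y, hx, hy, ?_⟩
  calc ∑ j, |(v ᵥ* B) j| = v ᵥ* B ⬝ᵥ η := Finset.sum_congr rfl fun j _ => (self_mul_sign _).symm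
    _ = v ⬝ᵥ B *ᵥ η := (dotProduct_mulVec v B η).symm
    _ ≤ ∑ i, |(B *ᵥ η) i| := dotProduct_le_sum_abs hv _
    _ ≤ 4 * |x ᵥ* B ⬝ᵥ y| := by linarith

theorem exists_isZeroOne_sum_sqrt_sum_sq_le (B : Matrix ι κ ℝ) :
    ∃ x y, IsZeroOne x ∧ IsZeroOne y ∧
      ∑ j, √(∑ i, B i j ^ 2) ≤ 4 * √3 * |x ᵥ* B ⬝ᵥ y| := by
  obtain ⟨ε, hε⟩ := exists_units_sum_sqrt_sum_sq_le B
  obtain ⟨x, y, hx, hy, hxy⟩ := exists_isZeroOne_sum_abs_vecMul_le B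
    (v := fun i => ((ε i : ℤ) : ℝ)) fun i => by
      rcases Int.units_eq_one_or (ε i) with h | h <;> simp [h]
  refine ⟨x, y, hx, hy, ?_⟩
  calc ∑ j, √(∑ i, B i j ^ 2) ≤ √3 * ∑ j, |∑ i, ε i • B i j| := hε
    _ = √3 * ∑ j, |((fun i => ((ε i : ℤ) : ℝ)) ᵥ* B) j| := by
        simp only [vecMul, dotProduct, Units.smul_def, zsmul_eq_mul]
    _ ≤ √3 * (4 * |x ᵥ* B ⬝ᵥ y|) := by gcongr
    _ = 4 * √3 * |x ᵥ* B ⬝ᵥ y| := by ring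

end ZeroOne

section Determinant

variable {ι : Type*} [Fintype ι] [DecidableEq ι]

theorem sqrt_card_le_sum_sqrt_sum_inv_sq {A : Matrix ι ι ℝ} (hA : ∀ i j, |A i j| ≤ 1)
    (hdet : IsUnit A.det) : √(Fintype.card ι) ≤ ∑ j, √(∑ i, A⁻¹ i j ^ 2) := by
  rcases isEmpty_or_nonempty ι with _ | _
  · simp
  have hrow (j : ι) : ∑ i, A j i ^ 2 ≤ Fintype.card ι := by
    simpa using Finset.sum_le_card_nsmul Finset.univ _ 1 fun i _ =>
      (sq_le_one_iff_abs_le_one _).2 (hA j i)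
  have hcol (j : ι) : 1 ≤ √(Fintype.card ι) * √(∑ i, A⁻¹ i j ^ 2) := calc
    1 = ∑ i, A j i * A⁻¹ i j := by rw [← mul_apply, mul_nonsing_inv A hdet, one_apply_eq]
    _ ≤ √(∑ i, A j i ^ 2) * √(∑ i, A⁻¹ i j ^ 2) := Real.sum_mul_le_sqrt_mul_sqrt _ _ _
    _ ≤ √(Fintype.card ι) * √(∑ i, A⁻¹ i j ^ 2) := by gcongr; exact hrow j
  have hcard : 0 < √(Fintype.card ι : ℝ) := Real.sqrt_pos.2 (mod_cast Fintype.card_pos)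
  refine le_of_mul_le_mul_left ?_ hcard
  rw [Real.mul_self_sqrt (Nat.cast_nonneg _), Finset.mul_sum]
  simpa using Finset.sum_le_sum fun j (_ : j ∈ Finset.univ) => hcol j

theorem det_fromBlocks_replicateCol_replicateRow_zero {R : Type*} [CommRing R] {A : Matrix ι ι R}
    (hdet : IsUnit A.det) (x y : ι → R) :
    (fromBlocks A (replicateCol Unit y) (replicateRow Unit x) 0).det =
      -(A.det * (x ᵥ* A⁻¹ ⬝ᵥ y)) := by
  have := A.invertibleOfIsUnitDet hdet
  rw [det_fromBlocks₁₁, invOf_eq_nonsing_inv, det_unique (n := Unit), ← replicateRow_vecMul]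
  simp [mul_apply, dotProduct]

theorem det_le_maxDet {A : Matrix ι ι ℝ} (hA : ∀ i, IsZeroOne (A i)) :
    A.det ≤ maxDet (Fintype.card ι) :=
  (isGreatest_maxDet _).2 ⟨A.reindex (Fintype.equivFin ι) (Fintype.equivFin ι),
    fun _ _ => hA _ _, det_reindex_self _ _⟩

theorem abs_det_le_maxDet {A : Matrix ι ι ℝ} (hA : ∀ i, IsZeroOne (A i)) :
    |A.det| ≤ maxDet (Fintype.card ι) := by
  refine abs_le'.2 ⟨det_le_maxDet hA, ?_⟩
  rcases subsingleton_or_nontrivial ι with _ | _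
  · have hdet : 0 ≤ A.det := by
      rcases isEmpty_or_nonempty ι with _ | ⟨⟨i⟩⟩
      · simp
      · rw [det_eq_elem_of_subsingleton A i]
        rcases hA i i with h | h <;> simp [h]
    linarith [maxDet_pos (Fintype.card ι)]
  · obtain ⟨i, j, hij⟩ := exists_pair_ne ι
    have hswap : (A.submatrix (Equiv.swap i j) id).det = -A.det := by
      rw [det_permute, Equiv.Perm.sign_swap hij]
      simp
    exact hswap ▸ det_le_maxDet fun k => hA (Equiv.swap i j k)

theorem abs_det_mul_le_maxDet_succ {A : Matrix ι ι ℝ} (hA : ∀ i, IsZeroOne (A i))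
    (hdet : IsUnit A.det) {x y : ι → ℝ} (hx : IsZeroOne x) (hy : IsZeroOne y) :
    |A.det| * |x ᵥ* A⁻¹ ⬝ᵥ y| ≤ maxDet (Fintype.card ι + 1) := by
  have hblock : ∀ i, IsZeroOne (fromBlocks A (replicateCol Unit y) (replicateRow Unit x) 0 i) := by
    rintro (i | i) (j | j)
    exacts [hA i j, hy i, hx j, Or.inl rfl]
  have h := abs_det_le_maxDet hblock
  rwa [det_fromBlocks_replicateCol_replicateRow_zero hdet, abs_neg, abs_mul, Fintype.card_sum,
    Fintype.card_unit] at h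

theorem maxDet_mul_sqrt_le (n : ℕ) : maxDet n * √n ≤ 4 * √3 * maxDet (n + 1) := by
  obtain ⟨A, hA, hmax⟩ := (isGreatest_maxDet n).1
  have hpos : 0 < A.det := hmax ▸ maxDet_pos n
  have hunit : IsUnit A.det := hpos.ne'.isUnit
  obtain ⟨x, y, hx, hy, hxy⟩ := exists_isZeroOne_sum_sqrt_sum_sq_le A⁻¹
  have hsqrt : √n ≤ ∑ j, √(∑ i, A⁻¹ i j ^ 2) := by
    simpa using sqrt_card_le_sum_sqrt_sum_inv_sq (fun i => IsZeroOne.abs_le_one (hA i)) hunit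
  have hborder : A.det * |x ᵥ* A⁻¹ ⬝ᵥ y| ≤ maxDet (n + 1) := by
    simpa [abs_of_pos hpos] using abs_det_mul_le_maxDet_succ hA hunit hx hy
  calc maxDet n * √n ≤ A.det * (4 * √3 * |x ᵥ* A⁻¹ ⬝ᵥ y|) := by
        rw [← hmax]
        gcongr
        exact hsqrt.trans hxy
    _ = 4 * √3 * (A.det * |x ᵥ* A⁻¹ ⬝ᵥ y|) := by ring
    _ ≤ 4 * √3 * maxDet (n + 1) := by gcongr

end Determinant

section MaximumPrinciple

theorem exists_norm_le_of_forall_mem_convexHull {ι F : Type*} [Finite ι]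
    {E : ι → Type*} [∀ i, AddCommGroup (E i)] [∀ i, Module ℝ (E i)] [NormedAddCommGroup F]
    [NormedSpace ℝ F] (f : MultilinearMap ℝ E F) {s : ∀ i, Set (E i)} {p : ∀ i, E i}
    (hp : ∀ i, p i ∈ convexHull ℝ (s i)) : ∃ q : ∀ i, E i, (∀ i, q i ∈ s i) ∧ ‖f p‖ ≤ ‖f q‖ := by
  classical
  have := Fintype.ofFinite ι
  suffices h : ∀ t : Finset ι, ∃ q : ∀ i, E i,
      (∀ i ∈ t, q i ∈ s i) ∧ (∀ i ∉ t, q i = p i) ∧ ‖f p‖ ≤ ‖f q‖ by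
    obtain ⟨q, hq, -, hle⟩ := h Finset.univ
    exact ⟨q, fun i => hq i (Finset.mem_univ i), hle⟩
  intro t
  induction t using Finset.induction_on with
  | empty => exact ⟨p, by simp, fun _ _ => rfl, le_rfl⟩
  | insert i t hi ih =>
    obtain ⟨q, hqs, hqp, hle⟩ := ih
    have hconvex := convexOn_univ_norm.comp_linearMap (f.toLinearMap q i)
    obtain ⟨y, hy, hqy⟩ := hconvex.exists_ge_of_mem_convexHull (Set.subset_univ _)
      (hqp i hi ▸ hp i)
    refine ⟨Function.update q i y, fun k hk => ?_, fun k hk => ?_, hle.trans ?_⟩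
    · rcases eq_or_ne k i with rfl | hki
      · simpa using hy
      · simpa [hki] using hqs k ((Finset.mem_insert.1 hk).resolve_left hki)
    · rw [Finset.mem_insert, not_or] at hk
      simpa [hk.1] using hqp k hk.2
    · simpa using hqy

theorem unitCube_eq_convexHull (n : ℕ) : unitCube n = convexHull ℝ {x | IsZeroOne x} := by
  have hpi : {x : Fin n → ℝ | IsZeroOne x} = Set.univ.pi fun _ => {0, 1} := by
    ext x
    simp [IsZeroOne]
  rw [hpi, convexHull_pi]
  ext x
  simp [unitCube, convexHull_pair, segment_eq_Icc, Pi.le_def, forall_and]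

variable {ι : Type*} [Fintype ι] [DecidableEq ι]

theorem abs_det_le_maxDet_of_isZeroOne_or_neg {A : Matrix ι ι ℝ}
    (hA : ∀ i, IsZeroOne (A i) ∨ IsZeroOne (-A i)) : |A.det| ≤ maxDet (Fintype.card ι) := by
  have hsign (i : ι) : ∃ σ : ℝ, |σ| = 1 ∧ IsZeroOne (σ • A i) := by
    rcases hA i with h | h
    · exact ⟨1, abs_one, by rwa [one_smul]⟩
    · exact ⟨-1, by simp, by rwa [neg_one_smul]⟩
  choose σ hσ hσA using hsign
  calc |A.det| = |(of fun i j => σ i * A i j).det| := by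
        rw [det_mul_column, abs_mul, Finset.abs_prod, Finset.prod_eq_one fun i _ => hσ i, one_mul]
    _ ≤ maxDet (Fintype.card ι) := abs_det_le_maxDet hσA

theorem abs_det_le_maxDet_of_mem_convexHull {A : Matrix ι ι ℝ}
    (hA : ∀ i, A i ∈ convexHull ℝ {v | IsZeroOne v ∨ IsZeroOne (-v)}) :
    |A.det| ≤ maxDet (Fintype.card ι) := by
  obtain ⟨B, hB, hle⟩ := exists_norm_le_of_forall_mem_convexHull
    (detRowAlternating (n := ι) (R := ℝ)).toMultilinearMap hA
  exact hle.trans (abs_det_le_maxDet_of_isZeroOne_or_neg hB)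

/-- The matrix whose columns are the edges `p (j + 1) - p 0` of the simplex with vertices `p`
that issue from `p 0`. -/
def edgeMatrix {n : ℕ} (p : Fin (n + 1) → Fin n → ℝ) : Matrix (Fin n) (Fin n) ℝ :=
  of fun i j => p j.succ i - p 0 i

theorem sub_mem_convexHull_isZeroOne_or_neg {n : ℕ} {y : Fin (n + 1) → ℝ}
    (hy : y ∈ unitCube (n + 1)) :
    (fun j : Fin n => y j.succ - y 0) ∈ convexHull ℝ {v | IsZeroOne v ∨ IsZeroOne (-v)} := by
  let L : (Fin (n + 1) → ℝ) →ₗ[ℝ] Fin n → ℝ :=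
    LinearMap.funLeft ℝ ℝ Fin.succ - LinearMap.pi fun _ => LinearMap.proj 0
  have hL : L y ∈ convexHull ℝ (L '' {x | IsZeroOne x}) := by
    rw [← L.image_convexHull, ← unitCube_eq_convexHull]
    exact Set.mem_image_of_mem L hy
  refine convexHull_mono ?_ hL
  rintro _ ⟨x, hx, rfl⟩
  rcases hx 0 with h0 | h0
  · exact Or.inl fun j => by simpa [L, h0] using hx j.succ
  · exact Or.inr fun j => by simpa [L, h0] using hx.one_sub j.succ

theorem abs_det_edgeMatrix_le_maxDet {n : ℕ} {p : Fin (n + 1) → Fin n → ℝ}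
    (hp : ∀ k, p k ∈ unitCube n) : |(edgeMatrix p).det| ≤ maxDet n := by
  simpa using abs_det_le_maxDet_of_mem_convexHull (A := edgeMatrix p) fun i =>
    sub_mem_convexHull_isZeroOne_or_neg (y := fun k => p k i) fun k => hp k i

end MaximumPrinciple

section Simplex

/-- The simplex `{x | 0 ≤ x, ∑ i, x i ≤ s}` cut off a corner of the orthant; it is empty for
`s < 0`, and for `s = 1` it is the convex hull of `0` and the standard basis. -/
def cornerSimplex (n : ℕ) (s : ℝ) : Set (Fin n → ℝ) := {x | (∀ i, 0 ≤ x i) ∧ ∑ i, x i ≤ s}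

theorem measurableSet_cornerSimplex (n : ℕ) (s : ℝ) : MeasurableSet (cornerSimplex n s) := by
  unfold cornerSimplex
  measurability

theorem cons_mem_cornerSimplex {n : ℕ} {s t : ℝ} {x : Fin n → ℝ} :
    (Fin.cons t x : Fin (n + 1) → ℝ) ∈ cornerSimplex (n + 1) s ↔
      0 ≤ t ∧ x ∈ cornerSimplex n (s - t) := by
  simp [cornerSimplex, Fin.forall_fin_succ, Fin.sum_univ_succ, le_sub_iff_add_le', and_assoc]

theorem cornerSimplex_eq_empty {n : ℕ} {s : ℝ} (hs : s < 0) : cornerSimplex n s = ∅ :=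
  Set.eq_empty_of_forall_notMem fun _ hx =>
    hs.not_ge ((Finset.sum_nonneg fun i _ => hx.1 i).trans hx.2)

theorem integral_sub_pow_div_factorial (n : ℕ) (s : ℝ) :
    ∫ t in 0..s, (s - t) ^ n / n ! = s ^ (n + 1) / (n + 1)! := by
  rw [intervalIntegral.integral_comp_sub_left fun u => u ^ n / (n ! : ℝ)]
  simp [integral_pow, Nat.factorial_succ, field]

theorem volume_cornerSimplex (n : ℕ) {s : ℝ} (hs : 0 ≤ s) :
    volume (cornerSimplex n s) = ENNReal.ofReal (s ^ n / n !) := by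
  induction n generalizing s with
  | zero => simp [cornerSimplex, hs, volume_pi]
  | succ n ih =>
    let e := MeasurableEquiv.piFinSuccAbove (fun _ : Fin (n + 1) => ℝ) 0
    have hslice (t : ℝ) : volume (Prod.mk t ⁻¹' (e.symm ⁻¹' cornerSimplex (n + 1) s)) =
        (Set.Icc 0 s).indicator (fun t => ENNReal.ofReal ((s - t) ^ n / n !)) t := by
      have hpre : Prod.mk t ⁻¹' (e.symm ⁻¹' cornerSimplex (n + 1) s) =
          {x | 0 ≤ t ∧ x ∈ cornerSimplex n (s - t)} := Set.ext fun x => by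
        simp [e, Fin.insertNthEquiv, cons_mem_cornerSimplex]
      rw [hpre]
      by_cases ht₀ : 0 ≤ t
      · rcases le_or_gt t s with hts | hts
        · simp [ht₀, hts, ih (sub_nonneg.2 hts)]
        · simp [hts.not_ge, cornerSimplex_eq_empty (sub_neg.2 hts)]
      · simp [ht₀]
    calc volume (cornerSimplex (n + 1) s)
        = volume (e.symm ⁻¹' cornerSimplex (n + 1) s) :=
          ((volume_preserving_piFinSuccAbove (fun _ : Fin (n + 1) => ℝ)
            0).symm.measure_preimage_equiv _).symm
      _ = ∫⁻ t in Set.Icc 0 s, ENNReal.ofReal ((s - t) ^ n / n !) := by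
          rw [Measure.volume_eq_prod, Measure.prod_apply
            (e.symm.measurable (measurableSet_cornerSimplex _ _))]
          simp_rw [hslice]
          rw [lintegral_indicator measurableSet_Icc]
      _ = ENNReal.ofReal (∫ t in 0..s, (s - t) ^ n / n !) := by
          rw [intervalIntegral.integral_of_le hs, ← integral_Icc_eq_integral_Ioc,
            ofReal_integral_eq_lintegral_ofReal]
          · exact Continuous.integrableOn_Icc (by fun_prop)
          · exact (ae_restrict_iff' measurableSet_Icc).2 <| .of_forall fun t ht =>
              div_nonneg (pow_nonneg (sub_nonneg.2 ht.2) n) (Nat.cast_nonneg _)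
      _ = ENNReal.ofReal (s ^ (n + 1) / (n + 1)!) := by rw [integral_sub_pow_div_factorial]

theorem convexHull_range_eq_image_cornerSimplex {E : Type*} [AddCommGroup E] [Module ℝ E] {n : ℕ}
    (p : Fin (n + 1) → E) :
    convexHull ℝ (Set.range p) =
      (fun x => p 0 + ∑ j, x j • (p j.succ - p 0)) '' cornerSimplex n 1 := by
  have hrange : Set.range p =
      Fintype.linearCombination ℝ p '' Set.range fun i => Pi.single i 1 := by
    simp [← Set.range_comp, Function.comp_def, Fintype.linearCombination_apply_single]
  have hcomb (w : Fin (n + 1) → ℝ) (hw : ∑ i, w i = 1) :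
      Fintype.linearCombination ℝ p w = p 0 + ∑ j, Fin.tail w j • (p j.succ - p 0) := by
    rw [Fin.sum_univ_succ, ← eq_sub_iff_add_eq] at hw
    simp only [Fintype.linearCombination_apply, Fin.sum_univ_succ, Fin.tail, smul_sub,
      Finset.sum_sub_distrib, ← Finset.sum_smul, hw]
    module
  rw [hrange, ← LinearMap.image_convexHull, convexHull_rangle_single_eq_stdSimplex]
  ext y
  constructor
  · rintro ⟨w, ⟨hw₀, hw₁⟩, rfl⟩
    refine ⟨Fin.tail w, ⟨fun j => hw₀ j.succ, ?_⟩, (hcomb w hw₁).symm⟩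
    rw [← hw₁, Fin.sum_univ_succ]
    exact le_add_of_nonneg_left (hw₀ 0)
  · rintro ⟨x, ⟨hx₀, hx₁⟩, rfl⟩
    have hsum : ∑ i, (Fin.cons (1 - ∑ j, x j) x : Fin (n + 1) → ℝ) i = 1 := by
      simp [Fin.sum_univ_succ]
    exact ⟨_, ⟨Fin.cases (sub_nonneg.2 hx₁) hx₀, hsum⟩, hcomb _ hsum⟩

theorem volume_convexHull_range {n : ℕ} (p : Fin (n + 1) → Fin n → ℝ) :
    volume.real (convexHull ℝ (Set.range p)) = |(edgeMatrix p).det| / n ! := by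
  have himage : convexHull ℝ (Set.range p) =
      (fun x => p 0 + x) '' (toLin' (edgeMatrix p) '' cornerSimplex n 1) := by
    rw [convexHull_range_eq_image_cornerSimplex, Set.image_image]
    congr! with x
    ext i
    simp [edgeMatrix, mulVec, dotProduct, mul_comm]
  rw [himage, measureReal_def, Set.image_add_left, measure_preimage_add,
    Measure.addHaar_image_linearMap, volume_cornerSimplex n zero_le_one, LinearMap.det_toLin',
    ← ENNReal.ofReal_mul (abs_nonneg _), ENNReal.toReal_ofReal (by positivity), one_pow,
    mul_one_div]

theorem maxSimplexVolume_eq (n : ℕ) : maxSimplexVolume n = maxDet n / n ! := by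
  refine IsGreatest.csSup_eq ⟨?_, ?_⟩
  · obtain ⟨A, hA, hmax⟩ := (isGreatest_maxDet n).1
    let p : Fin (n + 1) → Fin n → ℝ := Fin.cons 0 Aᵀ
    have hcube (k) : p k ∈ unitCube n := by
      rw [unitCube_eq_convexHull]
      refine subset_convexHull ℝ _ (Fin.cases (fun _ => Or.inl rfl) (fun j i => hA i j) k)
    have hvol : volume.real (convexHull ℝ (Set.range p)) = maxDet n / n ! := by
      have hedge : edgeMatrix p = A := by
        ext i j
        exact sub_zero (A i j)
      rw [volume_convexHull_range, hedge, hmax, abs_of_pos (maxDet_pos n)]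
    have hind : AffineIndependent ℝ p := (volume_hull_pos_iff p).1 <| by
      have := maxDet_pos n
      rw [hvol]
      positivity
    exact ⟨⟨p, hind⟩, convexHull_min (Set.range_subset_iff.2 hcube) (convex_unitCube n), hvol⟩
  · rintro _ ⟨S, hS, rfl⟩
    rw [volume_convexHull_range]
    gcongr
    exact abs_det_edgeMatrix_le_maxDet fun k => hS (subset_convexHull ℝ _ ⟨k, rfl⟩)

theorem maxSimplexVolume_div_succ (n : ℕ) :
    maxSimplexVolume n / maxSimplexVolume (n + 1) = (n + 1) * (maxDet n / maxDet (n + 1)) := by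
  have := maxDet_pos (n + 1)
  rw [maxSimplexVolume_eq, maxSimplexVolume_eq, Nat.factorial_succ]
  push_cast
  field_simp

end Simplex

theorem corollary2 :
    ∃ c c₁ : ℝ, 0 < c ∧ 0 < c₁ ∧ ∀ n : ℕ, 1 ≤ n →
      maxDet (n + 1) / maxDet n ≥ c * Real.sqrt (n : ℝ) ∧
      maxSimplexVolume n / maxSimplexVolume (n + 1) ≤ c₁ * Real.sqrt (n : ℝ) := by
  refine ⟨1 / (4 * √3), 8 * √3, by positivity, by positivity, fun n hn => ?_⟩
  have hn₁ : (1 : ℝ) ≤ n := mod_cast hn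
  have hn₀ : 0 < √(n : ℝ) := by positivity
  have hdet := maxDet_mul_sqrt_le n
  have hpos := maxDet_pos n
  have hpos' := maxDet_pos (n + 1)
  constructor
  · rw [ge_iff_le, one_div_mul_eq_div, div_le_div_iff₀ (by positivity) hpos]
    linarith
  · have hratio : maxDet n / maxDet (n + 1) ≤ 4 * √3 / √n := by
      rwa [div_le_div_iff₀ hpos' hn₀]
    calc maxSimplexVolume n / maxSimplexVolume (n + 1)
        = (n + 1) * (maxDet n / maxDet (n + 1)) := maxSimplexVolume_div_succ n
      _ ≤ (n + n) * (4 * √3 / √n) := by gcongr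
      _ = 8 * √3 * (n / √n) := by ring
      _ = 8 * √3 * √n := by rw [Real.div_sqrt]
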